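/- Let $m,n\ge 1$ be integers and $d=m+n$. An $(m,n)$-weight vector is $\omega\in\mathbb R^d$ with $\omega_1\ge\dots\ge\omega_m>0$, $\omega_{m+1}\ge\dots\ge\omega_d>0$ and $\sum_{i\le m}\omega_i=\sum_{j>m}\omega_j=1$; put $$a^\omega_t=\mathrm{diag}(e^{\omega_1t},\dots,e^{\omega_mt},e^{-\omega_{m+1}t},\dots,e^{-\omega_dt}).$$ For a real $m\times n$ matrix $x=(x_{i,j})$ let $\Lambda_x=\begin{pmatrix}\mathbb I_m&x\\0&\mathbb I_n\end{pmatrix}\mathbb Z^d$. For a lattice $\Lambda\subset\mathbb R^d$ and $1\le i\le d$, let $\lambda_i(\Lambda)$ be the least $\lambda>0$ such that $\lambda\,[-1,1]^d$ contains $i$ linearly independent vectors of $\Lambda$, and let $L^\omega_i(\Lambda,t)=\log\lambda_i(a^\omega_t\Lambda)$ and $\boldsymbol L^\omega(\Lambda,t)=(L^\omega_1(\Lambda,t),\dots,L^\omega_d(\Lambda,t))$. For $1\le k\le d-1$, $\boldsymbol L^\omega(\Lambda,\cdot)$ is called connected at $k$ if the set $\{t\ge 0: L^\omega_k(\Lambda,t)=L^\omega_{k+1}(\Lambda,t)\}$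 is unbounded above. For $\mathcal R\subset\{1,\dots,n\}$ let $\mathcal D(\mathcal R)$ be the family of all minors $\det(x_{i_s,j_t})_{1\le s,t\le p}$ with $1\le p\le\min\{m,\#\mathcal R\}$, $1\le i_1<\dots<i_p\le m$ and $j_1<\dots<j_p$ in $\mathcal R$ (indexed by the choice of rows and columns). Let $\omega$ be an $(m,n)$-weight vector and $x$ a real $m\times n$ matrix. (a) Let $k\in\{m,\dots,d-1\}$. Suppose that for every $\mathcal R\subset\{1,\dots,n\}$ with $\#\mathcal R=d-k$, the number $1$ together with the family $\mathcal D(\mathcal R)$ is linearly independent over $\mathbb Q$. Then $\boldsymbol L^\omega(\Lambda_x,\cdot)$ is connected at $k$. (b) Let $k\in\{1,\dots,m\}$. Suppose that the number $1$ together with the family $\mathcal D(\{1,\dots,n\})$ is linearly independent over $\mathbb Q$. Then $\boldsymbol L^\omega(\Lambda_x,\cdot)$ is connected at $k$. -/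

import Mathlib

namespace ParamGeom

/-- `d`-dimensional real space, `d = m + n`, with coordinates split as `m + n`:
`Sum.inl i` is the `i`-th coordinate, `Sum.inr j` is the `(m + j)`-th coordinate. -/
abbrev Space (m n : ℕ) : Type := Fin m ⊕ Fin n → ℝ

/-- An `(m,n)`-weight vector: `ω₁ ≥ ⋯ ≥ ω_m > 0`, `ω_{m+1} ≥ ⋯ ≥ ω_d > 0`, both blocks with
sum `1`. -/
structure IsWeightVector {m n : ℕ} (ω : Space m n) : Prop where
  antitone_left : Antitone fun i : Fin m => ω (Sum.inl i)
  antitone_right : Antitone fun j : Fin n => ω (Sum.inr j)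
  pos : ∀ i, 0 < ω i
  sum_left : ∑ i : Fin m, ω (Sum.inl i) = 1
  sum_right : ∑ j : Fin n, ω (Sum.inr j) = 1

/-- The unipotent matrix `u(x)` with blocks `I_m, x, 0, I_n`. -/
def uMat {m n : ℕ} (x : Matrix (Fin m) (Fin n) ℝ) :
    Matrix (Fin m ⊕ Fin n) (Fin m ⊕ Fin n) ℝ :=
  Matrix.fromBlocks 1 x 0 1

/-- The diagonal flow `diag(e^{ω₁ t}, …, e^{ω_m t}, e^{-ω_{m+1} t}, …, e^{-ω_d t})`. -/
noncomputable def flow {m n : ℕ} (ω : Space m n) (t : ℝ) :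
    Matrix (Fin m ⊕ Fin n) (Fin m ⊕ Fin n) ℝ :=
  Matrix.diagonal (Sum.elim (fun i => Real.exp (ω (Sum.inl i) * t))
    (fun j => Real.exp (-(ω (Sum.inr j)) * t)))

/-- The image `A Λ` of an additive subgroup `Λ` of `ℝ^d` under a matrix `A`. -/
noncomputable def matImage {m n : ℕ} (A : Matrix (Fin m ⊕ Fin n) (Fin m ⊕ Fin n) ℝ)
    (Λ : AddSubgroup (Space m n)) : AddSubgroup (Space m n) :=
  Λ.map (Matrix.mulVecLin A).toAddMonoidHom

/-- The standard lattice `ℤ^d` in `ℝ^d`. -/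
def intLattice (m n : ℕ) : AddSubgroup (Space m n) where
  carrier := {v | ∃ z : Fin m ⊕ Fin n → ℤ, ∀ i, v i = (z i : ℝ)}
  zero_mem' := ⟨0, fun i => by simp⟩
  add_mem' := by
    rintro v w ⟨y, hy⟩ ⟨z, hz⟩
    exact ⟨y + z, fun i => by simp [hy i, hz i]⟩
  neg_mem' := by
    rintro v ⟨y, hy⟩
    exact ⟨-y, fun i => by simp [hy i]⟩

/-- The lattice `Λ_x = u(x) ℤ^d`. -/
noncomputable def latticeOf {m n : ℕ} (x : Matrix (Fin m) (Fin n) ℝ) :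
    AddSubgroup (Space m n) :=
  matImage (uMat x) (intLattice m n)

/-- The `i`-th successive minimum (`1 ≤ i ≤ d`) of `Λ` with respect to the cube
`{v : |v_j| ≤ 1 for all j}`: the least `r > 0` such that `r` times the cube contains `i`
linearly independent vectors of `Λ`. -/
noncomputable def succMin {m n : ℕ} (Λ : AddSubgroup (Space m n)) (i : ℕ) : ℝ :=
  sInf {r : ℝ | 0 < r ∧ ∃ v : Fin i → Space m n,
    LinearIndependent ℝ v ∧ ∀ s, v s ∈ Λ ∧ ∀ j, |v s j| ≤ r}

/-- `L^ω_i(Λ, t) = log λ_i(a^ω_t Λ)`. -/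
noncomputable def logMin {m n : ℕ} (ω : Space m n) (Λ : AddSubgroup (Space m n))
    (i : ℕ) (t : ℝ) : ℝ :=
  Real.log (succMin (matImage (flow ω t) Λ) i)

/-- `L^ω(Λ, ·)` is connected at `k`: the set of `t ≥ 0` with
`L^ω_k(Λ, t) = L^ω_{k+1}(Λ, t)` is unbounded above. -/
def ConnectedAt {m n : ℕ} (ω : Space m n) (Λ : AddSubgroup (Space m n)) (k : ℕ) : Prop :=
  ¬ BddAbove {t : ℝ | 0 ≤ t ∧ logMin ω Λ k t = logMin ω Λ (k + 1) t}

/-- Index of a minor of an `m × n` matrix with columns in `R`: a size `p` with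
`1 ≤ p ≤ min m #R`, rows `i₁ < ⋯ < i_p` and columns `j₁ < ⋯ < j_p` in `R`. -/
structure MinorIndex (m : ℕ) {n : ℕ} (R : Finset (Fin n)) where
  p : ℕ
  one_le : 1 ≤ p
  le_min : p ≤ min m R.card
  row : Fin p ↪o Fin m
  col : Fin p ↪o Fin n
  col_mem : ∀ t, col t ∈ R

/-- The minor of `x` with the given index. -/
noncomputable def minor {m n : ℕ} (x : Matrix (Fin m) (Fin n) ℝ) {R : Finset (Fin n)}
    (a : MinorIndex m R) : ℝ :=
  (x.submatrix a.row a.col).det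

/-- The number `1` together with the family `𝒟(R)` of all minors of `x` with columns in `R`
is linearly independent over `ℚ`. -/
def MinorsIndependent {m n : ℕ} (x : Matrix (Fin m) (Fin n) ℝ) (R : Finset (Fin n)) : Prop :=
  LinearIndependent ℚ (fun a : Option (MinorIndex m R) => a.elim (1 : ℝ) (minor x))

end ParamGeom

namespace ParamGeom

open Module

/-! Put d = m + n, q = d - k, and suppose connectedness at k fails. Eventually the k-th and (k+1)-st
minima differ, and the integer vectors z for which a_t u(x) z is shorter than the (k+1)-st minimum
span a k-dimensional space. It is locally constant in t, hence a fixed rational space V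
(`exists_shortSpan_eq_of_not_connectedAt`).

By Minkowski's second theorem V contains, at each late time t, k independent integer vectors whose
images under a_t u(x) have norms with bounded product. Adjoining q unit vectors e_c to these images
gives a bounded determinant. Up to a factor bounded below, it is det(Z | u(-x) e_c) e^{ηt}, where Z
is a fixed integer basis of V and -η is the total exponent of the coordinates c. So det(Z | u(-x)
e_c) = 0 whenever η > 0 (`exists_colDet_eq_zero_of_not_connectedAt`).

This determinant is a rational combination of 1 and the minors of x in the right columns named by c,
so independence makes it vanish for every matrix y. But V has a complement spanned by unit vectors
e_{c'}, and after trading left coordinates of c' for right ones some y still gives a nonzero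
determinant (`exists_colDet_uMat_ne_zero`). It remains to choose c with η > 0. For k ≥ m, take q ≤ n
right coordinates. For k ≤ m, take all right coordinates and some left ones: η is then the total
weight of the k ≥ 1 omitted left coordinates. -/

/-- An integer vector viewed as a real vector. -/
def intVec {ι : Type*} (z : ι → ℤ) : ι → ℝ := fun i => (z i : ℝ)

theorem intVec_zero {ι : Type*} : intVec (0 : ι → ℤ) = 0 := by
  ext i; simp [intVec]

theorem intVec_injective {ι : Type*} : Function.Injective (intVec : (ι → ℤ) → ι → ℝ) := by
  intro a b h
  ext i
  have : (a i : ℝ) = b i := congrFun h i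
  exact_mod_cast this

/-! ### Minkowski's theorems and reduced systems of integer vectors -/

/-- **Minkowski's linear forms theorem** for a unimodular system of forms. -/
theorem exists_int_forms_lt {ι : Type*} [Fintype ι] [DecidableEq ι] (M : Matrix ι ι ℝ)
    (hM : |M.det| = 1) (r : ι → ℝ) (hr : ∀ i, 0 < r i) (h : 1 < ∏ i, r i) :
    ∃ z : ι → ℤ, z ≠ 0 ∧ ∀ i, |(M.mulVec (intVec z)) i| < r i := by
  set b := Pi.basisFun ℝ ι with hb
  set box : Set (ι → ℝ) := Set.pi Set.univ fun i => Set.Ioo (-r i) (r i) with hbox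
  set s : Set (ι → ℝ) := M.mulVecLin ⁻¹' box with hs
  have hmem : ∀ v, v ∈ s ↔ ∀ i, |M.mulVec v i| < r i := by
    intro v
    simp [hs, hbox, abs_lt]
  have hdet : LinearMap.det M.mulVecLin = M.det := by
    rw [← Matrix.toLin'_apply', LinearMap.det_toLin']
  have hdet0 : LinearMap.det M.mulVecLin ≠ 0 := by
    rw [hdet]; intro h0; rw [h0] at hM; simp at hM
  have hvol : MeasureTheory.volume s = ENNReal.ofReal (∏ i, (2 * r i)) := by
    rw [hs, MeasureTheory.Measure.addHaar_preimage_linearMap _ hdet0, hdet, abs_inv, hM, hbox,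
      MeasureTheory.volume_pi, MeasureTheory.Measure.pi_pi,
      ENNReal.ofReal_prod_of_nonneg (fun i _ => by have := hr i; positivity)]
    simp [Real.volume_Ioo, two_mul]
  have hconv : Convex ℝ s := by
    apply Convex.linear_preimage
    exact convex_pi fun i _ => convex_Ioo _ _
  have hF : MeasureTheory.volume (ZSpan.fundamentalDomain b) = 1 := by
    rw [ZSpan.volume_fundamentalDomain]
    have : Matrix.of b = (1 : Matrix ι ι ℝ) := by
      ext i j; simp [hb, Pi.basisFun_apply, Matrix.one_apply, Pi.single_apply, eq_comm]
    rw [this]; simp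
  have : Countable (Submodule.span ℤ (Set.range b)).toAddSubgroup :=
    inferInstanceAs (Countable (Submodule.span ℤ (Set.range b)))
  obtain ⟨⟨v, hvL⟩, hv0, hvs⟩ :=
    MeasureTheory.exists_ne_zero_mem_lattice_of_measure_mul_two_pow_lt_measure
      (ZSpan.isAddFundamentalDomain' b MeasureTheory.volume) (s := s)
      (fun v hv => by
        rw [hmem] at hv ⊢
        intro i
        rw [Matrix.mulVec_neg, Pi.neg_apply, abs_neg]
        exact hv i) hconv (by
        rw [hF, hvol, one_mul, Finset.prod_mul_distrib, Finset.prod_const, Module.finrank_pi,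
          Finset.card_univ, ENNReal.ofReal_mul (by positivity), ENNReal.ofReal_pow (by norm_num)]
        simp only [ENNReal.ofReal_ofNat]
        conv_lhs => rw [← mul_one ((2 : ENNReal) ^ Fintype.card ι)]
        rw [ENNReal.mul_lt_mul_iff_right (by positivity) (by finiteness)]
        simpa using h)
  have hvL' : v ∈ Submodule.span ℤ (Set.range b) := hvL
  rw [Module.Basis.mem_span_iff_repr_mem] at hvL'
  choose z hz using hvL'
  have hzv : intVec z = v := by
    ext i
    simpa [hb, intVec] using hz i
  refine ⟨z, ?_, ?_⟩
  · rintro rfl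
    apply hv0
    exact Subtype.ext (hzv.symm.trans intVec_zero)
  · rw [hzv]
    exact (hmem v).1 hvs

theorem finite_int_norm_mulVec_le {ι : Type*} [Fintype ι] [DecidableEq ι] (A : Matrix ι ι ℝ)
    (hA : IsUnit A.det) (r : ℝ) : {z : ι → ℤ | ‖A.mulVec (intVec z)‖ ≤ r}.Finite := by
  set B := A⁻¹
  let f : (ι → ℝ) →L[ℝ] (ι → ℝ) := LinearMap.toContinuousLinearMap B.mulVecLin
  have hf : ∀ v, f (A.mulVec v) = v := fun v => by
    change B.mulVec (A.mulVec v) = v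
    rw [Matrix.mulVec_mulVec, Matrix.nonsing_inv_mul _ hA, Matrix.one_mulVec]
  apply (Set.finite_Icc (fun _ : ι => -⌈‖f‖ * r⌉) (fun _ : ι => ⌈‖f‖ * r⌉)).subset
  intro z hz
  have h1 : ∀ i, |(z i : ℝ)| ≤ ⌈‖f‖ * r⌉ := by
    intro i
    calc |(z i : ℝ)| = ‖intVec z i‖ := rfl
      _ ≤ ‖intVec z‖ := norm_le_pi_norm _ i
      _ = ‖f (A.mulVec (intVec z))‖ := by rw [hf]
      _ ≤ ‖f‖ * ‖A.mulVec (intVec z)‖ := f.le_opNorm _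
      _ ≤ ‖f‖ * r := mul_le_mul_of_nonneg_left hz (norm_nonneg _)
      _ ≤ _ := Int.le_ceil _
  rw [Set.mem_Icc]
  constructor <;> intro i <;> have := abs_le.1 (h1 i)
  · exact_mod_cast this.1
  · exact_mod_cast this.2

/-- Integer vectors chosen successively, each minimizing `‖A z‖` off the span of the previous. -/
structure IsReduced {ι : Type*} [Fintype ι] (A : Matrix ι ι ℝ) {p : ℕ}
    (y : Fin p → ι → ℤ) : Prop where
  linearIndependent : LinearIndependent ℝ fun i => intVec (y i)
  le : ∀ i (z : ι → ℤ), intVec z ∉ Submodule.span ℝ ((fun j => intVec (y j)) '' {j | j < i}) →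
    ‖A.mulVec (intVec (y i))‖ ≤ ‖A.mulVec (intVec z)‖

theorem exists_intVec_notMem {ι : Type*} [Fintype ι] [DecidableEq ι] (W : Submodule ℝ (ι → ℝ))
    (hW : W ≠ ⊤) : ∃ z : ι → ℤ, intVec z ∉ W := by
  by_contra! h
  apply hW
  rw [eq_top_iff, ← (Pi.basisFun ℝ ι).span_eq, Submodule.span_le]
  rintro _ ⟨i, rfl⟩
  have := h (Pi.single i 1)
  convert! this using 1
  ext j
  simp [intVec, Pi.single_apply]

theorem exists_isReduced {ι : Type*} [Fintype ι] [DecidableEq ι] (A : Matrix ι ι ℝ)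
    (hA : IsUnit A.det) (p : ℕ) (hp : p ≤ Fintype.card ι) :
    ∃ y : Fin p → ι → ℤ, IsReduced A y := by
  induction p with
  | zero => exact ⟨Fin.elim0, linearIndependent_empty_type, fun i => i.elim0⟩
  | succ p ih =>
    obtain ⟨y, hy, hmin⟩ := ih (by omega)
    set W := Submodule.span ℝ (Set.range fun j => intVec (y j)) with hWdef
    have hW : W ≠ ⊤ := by
      intro h
      have := finrank_span_eq_card hy
      rw [← hWdef, h, finrank_top, Module.finrank_pi, Fintype.card_fin] at this
      omega
    obtain ⟨z₀, hz₀⟩ := exists_intVec_notMem W hW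
    obtain ⟨z, hz, hzmin⟩ := Set.exists_min_image
      {z : ι → ℤ | intVec z ∉ W ∧ ‖A.mulVec (intVec z)‖ ≤ ‖A.mulVec (intVec z₀)‖}
      (fun z => ‖A.mulVec (intVec z)‖)
      ((finite_int_norm_mulVec_le A hA _).subset fun z hz => hz.2) ⟨z₀, hz₀, le_rfl⟩
    have hcomp : (fun i => intVec ((Fin.snoc y z : Fin (p + 1) → ι → ℤ) i)) =
        Fin.snoc (fun i => intVec (y i)) (intVec z) := by
      ext i
      refine Fin.lastCases ?_ (fun i => ?_) i <;> simp
    refine ⟨Fin.snoc y z, ?_, ?_⟩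
    · rw [hcomp, linearIndependent_finSnoc]
      exact ⟨hy, hz.1⟩
    · intro i
      rw [hcomp]
      refine Fin.lastCases ?_ (fun i => ?_) i
      · intro w hw
        have hw' : intVec w ∉ W := by
          refine fun h => hw ?_
          refine Submodule.span_mono ?_ h
          rintro _ ⟨j, rfl⟩
          exact ⟨Fin.castSucc j, Fin.castSucc_lt_last j, by simp⟩
        simp only [Fin.snoc_last]
        rcases le_total ‖A.mulVec (intVec w)‖ ‖A.mulVec (intVec z₀)‖ with h | h
        · exact hzmin w ⟨hw', h⟩
        · exact hz.2.trans h
      · intro w hw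
        simp only [Fin.snoc_castSucc]
        refine hmin i w fun h => hw ?_
        refine Submodule.span_mono ?_ h
        rintro _ ⟨j, hj, rfl⟩
        exact ⟨Fin.castSucc j, by simpa using hj, by simp⟩

theorem IsReduced.monotone {ι : Type*} [Fintype ι] {A : Matrix ι ι ℝ} {p : ℕ}
    {y : Fin p → ι → ℤ} (hy : IsReduced A y) :
    Monotone fun i => ‖A.mulVec (intVec (y i))‖ := by
  intro i j hij
  refine hy.le i (y j) fun h => ?_
  exact hy.linearIndependent.notMem_span_image (s := {l | l < i}) (x := j)
    (by simpa using hij) h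

theorem IsReduced.norm_pos {ι : Type*} [Fintype ι] [DecidableEq ι] {A : Matrix ι ι ℝ}
    (hA : IsUnit A.det) {p : ℕ} {y : Fin p → ι → ℤ} (hy : IsReduced A y) (i : Fin p) :
    0 < ‖A.mulVec (intVec (y i))‖ := by
  rw [norm_pos_iff]
  intro h
  exact hy.linearIndependent.ne_zero i
    (Matrix.mulVec_injective_of_isUnit ((Matrix.isUnit_iff_isUnit_det A).2 hA) (by simpa using h))

theorem norm_le_norm_toLp {ι : Type*} [Fintype ι] (v : ι → ℝ) :
    ‖v‖ ≤ ‖(WithLp.toLp 2 v : EuclideanSpace ℝ ι)‖ := by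
  rw [pi_norm_le_iff_of_nonneg (norm_nonneg _)]
  intro i
  exact PiLp.norm_apply_le (WithLp.toLp 2 v : EuclideanSpace ℝ ι) i

/-- The upper bound in **Minkowski's second theorem**, with a weak constant. -/
theorem IsReduced.prod_norm_le {ι : Type*} [Fintype ι] [DecidableEq ι] {A : Matrix ι ι ℝ}
    (hA : |A.det| = 1) {d : ℕ} (hd : Fintype.card ι = d) {y : Fin d → ι → ℤ}
    (hy : IsReduced A y) :
    ∏ i, ‖A.mulVec (intVec (y i))‖ ≤ (d : ℝ) ^ d := by
  have hA' : IsUnit A.det := by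
    rw [isUnit_iff_ne_zero]; intro h; rw [h] at hA; simp at hA
  rcases Nat.eq_zero_or_pos d with rfl | hdpos
  · simp
  by_contra! hlt
  set r : Fin d → ℝ := fun i => ‖A.mulVec (intVec (y i))‖ with hr
  let f : Fin d → EuclideanSpace ℝ ι := fun i => WithLp.toLp 2 (A.mulVec (intVec (y i)))
  have hcard : finrank ℝ (EuclideanSpace ℝ ι) = Fintype.card (Fin d) := by simp [hd]
  let b := InnerProductSpace.gramSchmidtOrthonormalBasis hcard f
  let e : Fin d ≃ ι := (Fintype.equivFinOfCardEq hd).symm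
  let B : Matrix ι ι ℝ := Matrix.of fun i j => b (e.symm i) j
  have hB : ∀ (v : ι → ℝ) i, B.mulVec v i = inner ℝ (b (e.symm i)) (WithLp.toLp 2 v) := by
    intro v i
    simp [B, Matrix.mulVec, dotProduct, PiLp.inner_apply, mul_comm]
  have hBB : B * B.transpose = 1 := by
    ext i j
    have h1 := orthonormal_iff_ite.1 b.orthonormal (e.symm i) (e.symm j)
    rw [Matrix.mul_apply, Matrix.one_apply]
    simp only [EmbeddingLike.apply_eq_iff_eq] at h1
    rw [← h1]
    simp [B, PiLp.inner_apply, mul_comm]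
  have hBdet : |B.det| = 1 := by
    have := congrArg Matrix.det hBB
    rw [Matrix.det_mul, Matrix.det_transpose, Matrix.det_one] at this
    rcases mul_self_eq_one_iff.1 this with h | h <;> simp [h]
  -- Minkowski for the box with half-sides r_i / d along the Gram–Schmidt axes; the negated bound
  -- says exactly that their product exceeds 1.
  obtain ⟨z, hz0, hz⟩ := exists_int_forms_lt (B * A)
    (by rw [Matrix.det_mul, abs_mul, hBdet, hA, one_mul]) (fun i => r (e.symm i) / d)
    (fun i => div_pos (hy.norm_pos hA' _) (by positivity)) (by
      rw [Equiv.prod_comp e.symm (fun i => r i / d), Finset.prod_div_distrib]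
      rw [lt_div_iff₀ (by simp; positivity)]
      simpa using hlt)
  have hzlt : ∀ i, |inner ℝ (b i) (WithLp.toLp 2 (A.mulVec (intVec z)))| < r i / d := by
    intro i
    have := hz (e i)
    rw [← Matrix.mulVec_mulVec, hB] at this
    simpa using this
  set v : EuclideanSpace ℝ ι := WithLp.toLp 2 (A.mulVec (intVec z)) with hv
  have hv0 : v ≠ 0 := by
    intro h
    apply hz0
    apply intVec_injective
    rw [intVec_zero]
    apply Matrix.mulVec_injective_of_isUnit ((Matrix.isUnit_iff_isUnit_det A).2 hA')
    have := congrArg WithLp.ofLp h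
    simpa [hv] using this
  have hsq : ‖v‖ ^ 2 = ∑ i, (inner ℝ (b i) v) ^ 2 := by
    rw [← b.sum_sq_norm_inner_right v]
    simp
  have hne : (Finset.univ.filter fun i => inner ℝ (b i) v ≠ 0).Nonempty := by
    by_contra! h
    apply hv0
    rw [Finset.filter_eq_empty_iff] at h
    have : ‖v‖ ^ 2 = 0 := by
      rw [hsq]
      refine Finset.sum_eq_zero fun i _ => ?_
      have := h (Finset.mem_univ i)
      simp only [not_not] at this
      simp [this]
    simpa using this
  -- Let i be the last axis on which A z has a nonzero coordinate. Then z is off the span of the y_j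
  -- with j < i, so ‖A z‖ ≥ r_i. Yet all nonzero coordinates are below r_i / d, so even the
  -- Euclidean norm is below r_i.
  obtain ⟨i, hi, hmax⟩ := Finset.exists_max_image _ id hne
  simp only [Finset.mem_filter, Finset.mem_univ, true_and, id] at hi hmax
  have hlow : r i ≤ ‖A.mulVec (intVec z)‖ := by
    refine hy.le i z fun hmem => hi ?_
    let φ : (ι → ℝ) →ₗ[ℝ] ℝ := (innerₛₗ ℝ (b i)).comp
      ((WithLp.linearEquiv 2 ℝ (ι → ℝ)).symm.toLinearMap.comp A.mulVecLin)
    have : Submodule.span ℝ ((fun j => intVec (y j)) '' {j | j < i}) ≤ LinearMap.ker φ := by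
      rw [Submodule.span_le]
      rintro _ ⟨j, hj, rfl⟩
      exact InnerProductSpace.gramSchmidtOrthonormalBasis_inv_triangular hcard f hj
    exact this hmem
  have hup : ‖v‖ ^ 2 < r i ^ 2 := by
    have hri : 0 < r i := hy.norm_pos hA' i
    have hd1 : (1 : ℝ) ≤ d := by exact_mod_cast hdpos
    calc ‖v‖ ^ 2 = ∑ j, (inner ℝ (b j) v) ^ 2 := hsq
      _ < ∑ j : Fin d, (r i / d) ^ 2 := by
        have key : ∀ j, (inner ℝ (b j) v) ^ 2 < (r i / d) ^ 2 := by
          intro j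
          by_cases hj : inner ℝ (b j) v = 0
          · rw [hj, zero_pow two_ne_zero]
            have : (0 : ℝ) < d := by linarith
            positivity
          · rw [← sq_abs]
            have : r j ≤ r i := hy.monotone (hmax j hj)
            have : r j / d ≤ r i / d := by gcongr
            have := hzlt j
            gcongr
            linarith
        exact Finset.sum_lt_sum_of_nonempty ⟨i, Finset.mem_univ i⟩ fun j _ => key j
      _ = r i ^ 2 / d := by
        simp; field_simp
      _ ≤ r i ^ 2 := div_le_self (by positivity) hd1
  have := norm_le_norm_toLp (A.mulVec (intVec z))
  have h2 : ‖v‖ < r i := lt_of_pow_lt_pow_left₀ 2 (norm_nonneg _) hup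
  linarith

/-- Partial products of the minima are bounded as well. -/
theorem IsReduced.prod_norm_castLE_le {ι : Type*} [Fintype ι] [DecidableEq ι] {A : Matrix ι ι ℝ}
    (hA : |A.det| = 1) {d : ℕ} (hd : Fintype.card ι = d) {y : Fin d → ι → ℤ}
    (hy : IsReduced A y) {k : ℕ} (hk : k ≤ d) :
    ∏ i : Fin k, ‖A.mulVec (intVec (y (Fin.castLE hk i)))‖ ≤ max 1 ((d : ℝ) ^ d) := by
  set r : Fin d → ℝ := fun i => ‖A.mulVec (intVec (y i))‖ with hr
  have hr0 : ∀ i, 0 ≤ r i := fun i => norm_nonneg _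
  obtain ⟨q, rfl⟩ := Nat.exists_eq_add_of_le hk
  change ∏ i : Fin k, r (Fin.castLE hk i) ≤ _
  -- If one of the first k norms exceeds 1, so do all the later ones, and the full product
  -- dominates; otherwise the partial product is at most 1.
  by_cases h : ∃ i : Fin k, 1 < r (Fin.castLE hk i)
  · obtain ⟨i, hi⟩ := h
    refine le_trans ?_ (le_max_right _ _)
    refine le_trans ?_ (hy.prod_norm_le hA hd)
    change _ ≤ ∏ i, r i
    rw [Fin.prod_univ_add]
    refine le_mul_of_one_le_right (Finset.prod_nonneg fun i _ => hr0 _) ?_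
    have : ∀ j : Fin q, 1 ≤ r (Fin.natAdd k j) := fun j =>
      hi.le.trans (hy.monotone (by
        rw [Fin.le_def]; simp; omega))
    calc (1 : ℝ) = ∏ j : Fin q, 1 := by simp
      _ ≤ _ := Finset.prod_le_prod (fun _ _ => zero_le_one) fun j _ => this j
  · push Not at h
    exact (Finset.prod_le_one (fun i _ => hr0 _) fun i _ => h i).trans (le_max_left _ _)

/-! ### The flow and the successive minima of its lattices -/

/-- The exponents of the diagonal flow. -/
def flowExp {m n : ℕ} (ω : Space m n) : Fin m ⊕ Fin n → ℝ :=
  Sum.elim (fun i => ω (Sum.inl i)) fun j => -ω (Sum.inr j)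

theorem flow_eq {m n : ℕ} (ω : Space m n) (t : ℝ) :
    flow ω t = Matrix.diagonal fun i => Real.exp (flowExp ω i * t) := by
  unfold flow
  congr 1
  ext i
  cases i <;> simp [flowExp]

theorem IsWeightVector.sum_flowExp {m n : ℕ} {ω : Space m n} (hω : IsWeightVector ω) :
    ∑ i, flowExp ω i = 0 := by
  simp [flowExp, Fintype.sum_sum_type, hω.sum_left, hω.sum_right]

theorem IsWeightVector.abs_flowExp_le {m n : ℕ} {ω : Space m n} (hω : IsWeightVector ω)
    (i : Fin m ⊕ Fin n) : |flowExp ω i| ≤ 1 := by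
  rcases i with i | j
  · simp only [flowExp, Sum.elim_inl, abs_of_pos (hω.pos _)]
    rw [← hω.sum_left]
    exact Finset.single_le_sum (f := fun i => ω (Sum.inl i)) (fun i _ => (hω.pos _).le)
      (Finset.mem_univ i)
  · simp only [flowExp, Sum.elim_inr, abs_neg, abs_of_pos (hω.pos _)]
    rw [← hω.sum_right]
    exact Finset.single_le_sum (f := fun i => ω (Sum.inr i)) (fun i _ => (hω.pos _).le)
      (Finset.mem_univ j)

/-- The matrix `a_t u(x)`. -/
noncomputable def flowMat {m n : ℕ} (ω : Space m n) (x : Matrix (Fin m) (Fin n) ℝ) (t : ℝ) :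
    Matrix (Fin m ⊕ Fin n) (Fin m ⊕ Fin n) ℝ :=
  flow ω t * uMat x

theorem det_uMat {m n : ℕ} (x : Matrix (Fin m) (Fin n) ℝ) : (uMat x).det = 1 := by
  simp [uMat]

theorem det_flowMat {m n : ℕ} {ω : Space m n} (hω : IsWeightVector ω)
    (x : Matrix (Fin m) (Fin n) ℝ) (t : ℝ) : (flowMat ω x t).det = 1 := by
  rw [flowMat, Matrix.det_mul, det_uMat, flow_eq, Matrix.det_diagonal, ← Real.exp_sum,
    ← Finset.sum_mul, hω.sum_flowExp]
  simp

theorem mem_matImage_latticeOf {m n : ℕ} (ω : Space m n) (x : Matrix (Fin m) (Fin n) ℝ) (t : ℝ)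
    (v : Space m n) : v ∈ matImage (flow ω t) (latticeOf x) ↔
      ∃ z, (flowMat ω x t).mulVec (intVec z) = v := by
  constructor
  · rintro ⟨_, ⟨w, ⟨z, hz⟩, rfl⟩, rfl⟩
    refine ⟨z, ?_⟩
    have : w = intVec z := funext hz
    rw [this, flowMat, ← Matrix.mulVec_mulVec]
    rfl
  · rintro ⟨z, rfl⟩
    refine ⟨_, ⟨intVec z, ⟨z, fun i => rfl⟩, rfl⟩, ?_⟩
    rw [flowMat, ← Matrix.mulVec_mulVec]
    rfl

/-- The set whose infimum is the `i`-th minimum of the lattice `A ℤ^d`. -/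
def minSet {ι : Type*} [Fintype ι] (A : Matrix ι ι ℝ) (i : ℕ) : Set ℝ :=
  {r : ℝ | 0 < r ∧ ∃ z : Fin i → ι → ℤ,
    LinearIndependent ℝ (fun s => intVec (z s)) ∧ ∀ s, ‖A.mulVec (intVec (z s))‖ ≤ r}

/-- Since a_t u(x) is injective, independence can be tested on the integer coordinate vectors. -/
theorem succMin_eq {m n : ℕ} {ω : Space m n} (hω : IsWeightVector ω)
    (x : Matrix (Fin m) (Fin n) ℝ) (t : ℝ) (i : ℕ) :
    succMin (matImage (flow ω t) (latticeOf x)) i = sInf (minSet (flowMat ω x t) i) := by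
  have hker : LinearMap.ker (flowMat ω x t).mulVecLin = ⊥ := by
    refine LinearMap.ker_eq_bot.2 ?_
    refine Matrix.mulVec_injective_of_isUnit ?_
    rw [Matrix.isUnit_iff_isUnit_det, det_flowMat hω]
    exact isUnit_one
  unfold succMin minSet
  congr 1
  ext r
  refine and_congr_right fun hr => ?_
  constructor
  · rintro ⟨v, hv, hvr⟩
    choose z hz using fun s => (mem_matImage_latticeOf ω x t (v s)).1 (hvr s).1
    refine ⟨z, ?_, fun s => ?_⟩
    · refine LinearIndependent.of_comp (flowMat ω x t).mulVecLin ?_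
      convert! hv using 1
      ext1 s
      exact hz s
    · rw [hz, pi_norm_le_iff_of_nonneg hr.le]
      exact (hvr s).2
  · rintro ⟨z, hz, hzr⟩
    have hli := hz.map' (flowMat ω x t).mulVecLin hker
    refine ⟨fun s => (flowMat ω x t).mulVec (intVec (z s)), hli, fun s => ⟨?_, ?_⟩⟩
    · exact (mem_matImage_latticeOf ω x t _).2 ⟨_, rfl⟩
    · exact (pi_norm_le_iff_of_nonneg hr.le).1 (hzr s)

theorem bddBelow_minSet {ι : Type*} [Fintype ι] (A : Matrix ι ι ℝ) (i : ℕ) :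
    BddBelow (minSet A i) := ⟨0, fun _ hr => hr.1.le⟩

theorem minSet_succ_subset {ι : Type*} [Fintype ι] (A : Matrix ι ι ℝ) (i : ℕ) :
    minSet A (i + 1) ⊆ minSet A i := by
  rintro r ⟨hr, z, hz, hzr⟩
  exact ⟨hr, fun s => z s.castSucc, hz.comp _ (Fin.castSucc_injective i), fun s => hzr _⟩

theorem minSet_nonempty {ι : Type*} [Fintype ι] [DecidableEq ι] (A : Matrix ι ι ℝ)
    (hA : IsUnit A.det) (i : ℕ) (hi : i ≤ Fintype.card ι) : (minSet A i).Nonempty := by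
  obtain ⟨y, hy⟩ := exists_isReduced A hA i hi
  refine ⟨1 + ∑ s, ‖A.mulVec (intVec (y s))‖, ?_, y, hy.linearIndependent, fun s => ?_⟩
  · have : 0 ≤ ∑ s, ‖A.mulVec (intVec (y s))‖ := Finset.sum_nonneg fun _ _ => norm_nonneg _
    linarith
  · have := Finset.single_le_sum (f := fun s => ‖A.mulVec (intVec (y s))‖)
      (fun _ _ => norm_nonneg _) (Finset.mem_univ s)
    linarith

/-! ### The span of the short vectors and its constancy in time -/

/-- The span of the integer vectors `z` with `‖A z‖ < r`. -/
def shortSpan {ι : Type*} [Fintype ι] (A : Matrix ι ι ℝ) (r : ℝ) : Submodule ℝ (ι → ℝ) :=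
  Submodule.span ℝ (intVec '' {z | ‖A.mulVec (intVec z)‖ < r})

/-- The integer vectors shorter than the `(k+1)`-st minimum span a space of dimension at most
`k`. -/
theorem finrank_shortSpan_le {ι : Type*} [Fintype ι] (A : Matrix ι ι ℝ) (k : ℕ)
    (hpos : 0 < sInf (minSet A (k + 1))) :
    finrank ℝ (shortSpan A (sInf (minSet A (k + 1)))) ≤ k := by
  set ρ := sInf (minSet A (k + 1)) with hρ
  by_contra! hlt
  obtain ⟨s, hs, hspan, hli⟩ := exists_linearIndependent ℝ
    (intVec '' {z : ι → ℤ | ‖A.mulVec (intVec z)‖ < ρ})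
  have hfin : s.Finite := hli.setFinite
  have := hfin.fintype
  have hcard : k + 1 ≤ Fintype.card s := by
    have h := finrank_span_eq_card hli
    rw [Subtype.range_coe, hspan] at h
    rw [← h]
    exact hlt
  obtain ⟨f⟩ : Nonempty (Fin (k + 1) ↪ s) := by
    rw [Function.Embedding.nonempty_iff_card_le]
    simpa using hcard
  choose z hz hzs using fun i : Fin (k + 1) => hs (f i).2
  -- The value ρ / 2 only keeps r positive, as membership in `minSet` demands.
  have hmax : ∃ r, 0 < r ∧ r < ρ ∧ ∀ i, ‖A.mulVec (intVec (z i))‖ ≤ r := by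
    obtain ⟨i, hi⟩ := Finite.exists_max fun i => ‖A.mulVec (intVec (z i))‖
    refine ⟨max (ρ / 2) ‖A.mulVec (intVec (z i))‖, ?_, ?_, fun j => (hi j).trans (le_max_right _ _)⟩
    · exact lt_max_of_lt_left (by linarith)
    · exact max_lt (by linarith) (hz i)
  obtain ⟨r, hr0, hrρ, hr⟩ := hmax
  refine absurd hrρ (not_lt.2 (csInf_le (bddBelow_minSet A _) ⟨hr0, z, ?_, hr⟩))
  have := hli.comp f f.injective
  convert! this using 1
  ext1 i
  exact hzs i

theorem le_finrank_shortSpan {ι : Type*} [Fintype ι] (A : Matrix ι ι ℝ) {k : ℕ} {r ρ : ℝ}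
    (hr : r ∈ minSet A k) (hrρ : r < ρ) : k ≤ finrank ℝ (shortSpan A ρ) := by
  obtain ⟨-, z, hz, hzr⟩ := hr
  have h := finrank_span_eq_card hz
  rw [Fintype.card_fin] at h
  rw [← h]
  refine Submodule.finrank_mono (Submodule.span_mono ?_)
  rintro _ ⟨s, rfl⟩
  exact ⟨z s, (hzr s).trans_lt hrρ, rfl⟩

/-- All exponents of the flow have absolute value at most 1. -/
theorem norm_flowMat_mulVec_le {m n : ℕ} {ω : Space m n} (hω : IsWeightVector ω)
    (x : Matrix (Fin m) (Fin n) ℝ) (s t : ℝ) (v : Space m n) :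
    ‖(flowMat ω x s).mulVec v‖ ≤ Real.exp |s - t| * ‖(flowMat ω x t).mulVec v‖ := by
  rw [pi_norm_le_iff_of_nonneg (by positivity)]
  intro i
  have hcoord : ∀ t, (flowMat ω x t).mulVec v i =
      Real.exp (flowExp ω i * t) * (uMat x).mulVec v i := by
    intro t
    rw [flowMat, ← Matrix.mulVec_mulVec, flow_eq, Matrix.mulVec_diagonal]
  have h1 : ‖(flowMat ω x t).mulVec v i‖ ≤ ‖(flowMat ω x t).mulVec v‖ := norm_le_pi_norm _ i
  have h2 : ‖(flowMat ω x s).mulVec v i‖ =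
      Real.exp (flowExp ω i * (s - t)) * ‖(flowMat ω x t).mulVec v i‖ := by
    rw [hcoord, hcoord, norm_mul, norm_mul, ← mul_assoc, Real.norm_of_nonneg (Real.exp_pos _).le,
      Real.norm_of_nonneg (Real.exp_pos _).le, ← Real.exp_add]
    ring_nf
  have h3 : flowExp ω i * (s - t) ≤ |s - t| := by
    refine (le_abs_self _).trans ?_
    rw [abs_mul]
    exact mul_le_of_le_one_left (abs_nonneg _) (hω.abs_flowExp_le i)
  rw [h2]
  gcongr

theorem sInf_minSet_flowMat_le {m n : ℕ} {ω : Space m n} (hω : IsWeightVector ω)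
    (x : Matrix (Fin m) (Fin n) ℝ) (s t : ℝ) (k : ℕ) (hk : k ≤ m + n) :
    sInf (minSet (flowMat ω x t) k) ≤ Real.exp |s - t| * sInf (minSet (flowMat ω x s) k) := by
  rw [← div_le_iff₀' (Real.exp_pos _)]
  refine le_csInf (minSet_nonempty _ (by rw [det_flowMat hω]; exact isUnit_one) _ (by simpa)) ?_
  rintro r ⟨hr, z, hz, hzr⟩
  rw [div_le_iff₀' (Real.exp_pos _)]
  refine csInf_le (bddBelow_minSet _ _) ⟨by positivity, z, hz, fun i => ?_⟩
  refine (norm_flowMat_mulVec_le hω x t s _).trans ?_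
  rw [abs_sub_comm]
  gcongr
  exact hzr i

/-- If `L^ω(Λ_x, ·)` is not connected at `k`, then from some time on the span of the first `k`
minima is well defined and constant. -/
theorem exists_shortSpan_eq_of_not_connectedAt {m n : ℕ} {ω : Space m n} (hω : IsWeightVector ω)
    (x : Matrix (Fin m) (Fin n) ℝ) {k : ℕ} (hk : k + 1 ≤ m + n)
    (h : ¬ ConnectedAt ω (latticeOf x) k) :
    ∃ (T : ℝ) (V : Submodule ℝ (Space m n)), finrank ℝ V = k ∧
      ∀ t, T ≤ t → ∃ r, shortSpan (flowMat ω x t) r = V := by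
  rw [ConnectedAt, not_not] at h
  obtain ⟨T₀, hT₀⟩ := h
  set T := max 0 (T₀ + 1) with hT
  set ρ : ℝ → ℕ → ℝ := fun t i => sInf (minSet (flowMat ω x t) i) with hρdef
  have hlt : ∀ t, T ≤ t → ρ t k < ρ t (k + 1) := by
    intro t ht
    have hne : ρ t k ≠ ρ t (k + 1) := by
      intro heq
      have h1 : 0 ≤ t := (le_max_left _ _).trans ht
      have h2 : T₀ + 1 ≤ t := (le_max_right _ _).trans ht
      have := hT₀ (show t ∈ _ from ⟨h1, by
        rw [logMin, logMin, succMin_eq hω, succMin_eq hω]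
        exact congrArg Real.log heq⟩)
      linarith
    refine lt_of_le_of_ne ?_ hne
    exact csInf_le_csInf (bddBelow_minSet _ _)
      (minSet_nonempty _ (by rw [det_flowMat hω]; exact isUnit_one) _ (by simpa using hk))
      (minSet_succ_subset _ _)
  have hpos : ∀ t, T ≤ t → 0 < ρ t (k + 1) := fun t ht =>
    lt_of_le_of_lt (Real.sInf_nonneg fun r hr => hr.1.le) (hlt t ht)
  set V : ℝ → Submodule ℝ (Space m n) := fun t => shortSpan (flowMat ω x t) (ρ t (k + 1)) with hV
  have hexists : ∀ t, T ≤ t → ∃ r, r ∈ minSet (flowMat ω x t) k ∧ r < ρ t (k + 1) := fun t ht =>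
    exists_lt_of_csInf_lt (minSet_nonempty _ (by rw [det_flowMat hω]; exact isUnit_one) _
      (by simp; omega)) (hlt t ht)
  have hrank : ∀ t, T ≤ t → finrank ℝ (V t) = k := by
    intro t ht
    obtain ⟨r, hr, hrρ⟩ := hexists t ht
    exact le_antisymm (finrank_shortSpan_le _ k (hpos t ht)) (le_finrank_shortSpan _ hr hrρ)
  have hloc : IsLocallyConstant fun t : Set.Ici T => V t := by
    rw [IsLocallyConstant.iff_eventually_eq]
    rintro ⟨t, ht⟩
    obtain ⟨r, ⟨hr0, z, hz, hzr⟩, hrρ⟩ := hexists t ht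
    -- One exponential pays for the growth of the k vectors z_i between t and s, the other for the
    -- drop of the (k+1)-st minimum. For s near t the z_i therefore stay short, and their span is
    -- both V s and V t.
    have hcont : ContinuousAt (fun s : Set.Ici T =>
        Real.exp |(s : ℝ) - t| * (Real.exp |(s : ℝ) - t| * r)) ⟨t, ht⟩ := by
      fun_prop
    have hev := hcont.eventually_lt_const (u := ρ t (k + 1)) (by simpa using hrρ)
    filter_upwards [hev] with s hs
    have hsle : ρ t (k + 1) ≤ Real.exp |(s : ℝ) - t| * ρ s (k + 1) :=
      sInf_minSet_flowMat_le hω x s t (k + 1) hk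
    have hzs : Submodule.span ℝ (Set.range fun i => intVec (z i)) ≤ V s := by
      refine Submodule.span_mono ?_
      rintro _ ⟨i, rfl⟩
      refine ⟨z i, ?_, rfl⟩
      have h1 : ‖(flowMat ω x s).mulVec (intVec (z i))‖ ≤ Real.exp |(s : ℝ) - t| * r :=
        (norm_flowMat_mulVec_le hω x s t _).trans (by gcongr; exact hzr i)
      have h2 : Real.exp |(s : ℝ) - t| * (Real.exp |(s : ℝ) - t| * r) <
          Real.exp |(s : ℝ) - t| * ρ s (k + 1) := lt_of_lt_of_le hs hsle
      exact lt_of_le_of_lt h1 (lt_of_mul_lt_mul_left h2 (Real.exp_pos _).le)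
    have hzt : Submodule.span ℝ (Set.range fun i => intVec (z i)) ≤ V t := by
      refine Submodule.span_mono ?_
      rintro _ ⟨i, rfl⟩
      exact ⟨z i, (hzr i).trans_lt hrρ, rfl⟩
    have hdim := finrank_span_eq_card hz
    rw [Fintype.card_fin] at hdim
    exact (Submodule.eq_of_le_of_finrank_eq hzs (by rw [hdim, hrank s s.2])).symm.trans
      (Submodule.eq_of_le_of_finrank_eq hzt (by rw [hdim, hrank t ht]))
  have : PreconnectedSpace (Set.Ici T) := Subtype.preconnectedSpace isPreconnected_Ici
  refine ⟨T, V T, hrank T le_rfl, fun t ht => ⟨ρ t (k + 1), ?_⟩⟩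
  exact hloc.apply_eq_of_preconnectedSpace ⟨t, ht⟩ ⟨T, Set.self_mem_Ici⟩

/-- The first `k` vectors of a reduced system lie in any `k`-dimensional span of short vectors. -/
theorem IsReduced.mem_shortSpan {ι : Type*} [Fintype ι] {A : Matrix ι ι ℝ} {p : ℕ}
    {y : Fin p → ι → ℤ} (hy : IsReduced A y) (r : ℝ) (i : Fin p)
    (hi : i < finrank ℝ (shortSpan A r)) : intVec (y i) ∈ shortSpan A r := by
  -- The i earlier vectors cannot span the space of short vectors, whose dimension exceeds i. A
  -- short z off their span bounds y_i by minimality.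
  have hex : ∃ z : ι → ℤ, ‖A.mulVec (intVec z)‖ < r ∧
      intVec z ∉ Submodule.span ℝ ((fun j => intVec (y j)) '' {j | j < i}) := by
    by_contra! hcon
    have hle : shortSpan A r ≤ Submodule.span ℝ ((fun j => intVec (y j)) '' {j | j < i}) := by
      refine Submodule.span_le.2 ?_
      rintro _ ⟨z, hz, rfl⟩
      exact hcon z hz
    have h1 := Submodule.finrank_mono hle
    classical
    have h2 := finrank_span_le_card (R := ℝ) ((fun j => intVec (y j)) '' {j | j < i})
    have h3 : ((fun j => intVec (y j)) '' {j | j < i}).toFinset.card ≤ i := by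
      have : ((fun j => intVec (y j)) '' {j | j < i}).toFinset =
          (Finset.Iio i).image fun j => intVec (y j) := by ext; simp
      rw [this]
      exact Finset.card_image_le.trans (by simp)
    omega
  obtain ⟨z, hz, hzn⟩ := hex
  exact Submodule.subset_span ⟨y i, (hy.le i z hzn).trans_lt hz, rfl⟩

/-! ### Rational combinations of minors -/

/-- The constant function `1` and the minors with columns in `R`, as functions of the matrix. -/
noncomputable def minorFun (m : ℕ) {n : ℕ} (R : Finset (Fin n)) (a : Option (MinorIndex m R))
    (y : Matrix (Fin m) (Fin n) ℝ) : ℝ :=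
  a.elim 1 (minor y)

/-- A square matrix all of whose entries are rational constants, apart from a block filled with
the entries of `-y`; rows and columns of that block carry the labels `some _`. -/
noncomputable def template {m n p : ℕ} (ρ : Fin p → Option (Fin m)) (κ : Fin p → Option (Fin n))
    (C : Matrix (Fin p) (Fin p) ℚ) (y : Matrix (Fin m) (Fin n) ℝ) : Matrix (Fin p) (Fin p) ℝ :=
  Matrix.of fun a b => (ρ a).elim (C a b : ℝ) fun i => (κ b).elim (C a b : ℝ) fun j => -y i j

/-- Repeated labels give 0, the empty determinant is the constant 1, and sorting distinct labels
only costs a sign. -/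
theorem det_submatrix_mem_span {m n p : ℕ} (R : Finset (Fin n)) (ρ : Fin p → Fin m)
    (κ : Fin p → Fin n) (hκ : ∀ b, κ b ∈ R) :
    (fun y : Matrix (Fin m) (Fin n) ℝ => (y.submatrix ρ κ).det) ∈
      Submodule.span ℚ (Set.range (minorFun m R)) := by
  by_cases hρi : Function.Injective ρ
  swap
  · obtain ⟨a, b, hab, hne⟩ := Function.not_injective_iff.1 hρi
    convert! Submodule.zero_mem _ using 1
    ext y
    exact Matrix.det_zero_of_row_eq hne (by ext j; simp [hab])
  by_cases hκi : Function.Injective κ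
  swap
  · obtain ⟨a, b, hab, hne⟩ := Function.not_injective_iff.1 hκi
    convert! Submodule.zero_mem _ using 1
    ext y
    exact Matrix.det_zero_of_column_eq hne (by intro j; simp [hab])
  rcases Nat.eq_zero_or_pos p with rfl | hp
  · have h := Submodule.subset_span (R := ℚ) (Set.mem_range_self (f := minorFun m R) none)
    convert! h using 1
    ext y
    simp [minorFun]
  have hρs : StrictMono (ρ ∘ Tuple.sort ρ) :=
    (Tuple.monotone_sort ρ).strictMono_of_injective (hρi.comp (Equiv.injective _))
  have hκs : StrictMono (κ ∘ Tuple.sort κ) :=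
    (Tuple.monotone_sort κ).strictMono_of_injective (hκi.comp (Equiv.injective _))
  have hpm : p ≤ m := by simpa using Fintype.card_le_of_injective ρ hρi
  have hpR : p ≤ R.card := by
    have := Finset.card_le_card_of_injOn κ (s := Finset.univ) (t := R) (fun b _ => hκ b)
      hκi.injOn
    simpa using this
  let a : MinorIndex m R := ⟨p, hp, le_min hpm hpR, OrderEmbedding.ofStrictMono _ hρs,
    OrderEmbedding.ofStrictMono _ hκs, fun t => hκ _⟩
  have key : ∀ y : Matrix (Fin m) (Fin n) ℝ, minorFun m R (some a) y =
      ((Equiv.Perm.sign (Tuple.sort ρ) * Equiv.Perm.sign (Tuple.sort κ) : ℤˣ) : ℤ) *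
        (y.submatrix ρ κ).det := by
    intro y
    have h1 := Matrix.det_permute (Tuple.sort ρ)
      ((y.submatrix ρ κ).submatrix id (Tuple.sort κ))
    have h2 := Matrix.det_permute' (Tuple.sort κ) (y.submatrix ρ κ)
    rw [h2] at h1
    push_cast
    rw [mul_assoc]
    exact h1
  have hmem := Submodule.smul_mem _
    (((Equiv.Perm.sign (Tuple.sort ρ) * Equiv.Perm.sign (Tuple.sort κ) : ℤˣ) : ℤ) : ℚ)
    (Submodule.subset_span (R := ℚ) (Set.mem_range_self (f := minorFun m R) (some a)))
  convert! hmem using 1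
  ext y
  rw [Pi.smul_apply, key]
  rcases Int.units_eq_one_or (Equiv.Perm.sign (Tuple.sort ρ) * Equiv.Perm.sign (Tuple.sort κ))
    with h | h <;> simp [h]

/-- Laplace expansion along a constant row or column keeps the shape with rational coefficients;
when none is left, the matrix is a block of -y. -/
theorem template_det_mem_span {m n p : ℕ} (R : Finset (Fin n)) (ρ : Fin p → Option (Fin m))
    (κ : Fin p → Option (Fin n)) (hκ : ∀ b, ∀ j ∈ κ b, j ∈ R) (C : Matrix (Fin p) (Fin p) ℚ) :
    (fun y : Matrix (Fin m) (Fin n) ℝ => (template ρ κ C y).det) ∈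
      Submodule.span ℚ (Set.range (minorFun m R)) := by
  induction p with
  | zero =>
    have h := Submodule.subset_span (R := ℚ)
      (Set.mem_range_self (f := minorFun m R) none)
    convert! h using 1
    ext y
    simp [minorFun]
  | succ p ih =>
    by_cases hρ : ∃ a, ρ a = none
    · obtain ⟨a, ha⟩ := hρ
      have : (fun y : Matrix (Fin m) (Fin n) ℝ => (template ρ κ C y).det) =
          ∑ b : Fin (p + 1), ((-1 : ℚ) ^ (a + b : ℕ) * C a b) •
            fun y : Matrix (Fin m) (Fin n) ℝ => (template (ρ ∘ a.succAbove) (κ ∘ b.succAbove)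
              (C.submatrix a.succAbove b.succAbove) y).det := by
        ext y
        rw [Matrix.det_succ_row _ a, Finset.sum_apply]
        refine Finset.sum_congr rfl fun b _ => ?_
        rw [Pi.smul_apply, Rat.smul_def]
        push_cast
        congr 1
        simp [template, ha]
      rw [this]
      exact Submodule.sum_mem _ fun b _ => Submodule.smul_mem _ _ (ih _ _ (fun _ => hκ _) _)
    by_cases hκn : ∃ b, κ b = none
    · obtain ⟨b, hb⟩ := hκn
      have : (fun y : Matrix (Fin m) (Fin n) ℝ => (template ρ κ C y).det) =
          ∑ a : Fin (p + 1), ((-1 : ℚ) ^ (a + b : ℕ) * C a b) •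
            fun y : Matrix (Fin m) (Fin n) ℝ => (template (ρ ∘ a.succAbove) (κ ∘ b.succAbove)
              (C.submatrix a.succAbove b.succAbove) y).det := by
        ext y
        rw [Matrix.det_succ_column _ b, Finset.sum_apply]
        refine Finset.sum_congr rfl fun a _ => ?_
        rw [Pi.smul_apply, Rat.smul_def]
        push_cast
        congr 1
        cases h : ρ a <;> simp [template, hb, h]
      rw [this]
      exact Submodule.sum_mem _ fun b _ => Submodule.smul_mem _ _ (ih _ _ (fun _ => hκ _) _)
    simp only [not_exists, ← ne_eq, Option.ne_none_iff_exists'] at hρ hκn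
    choose ρ' hρ' using hρ
    choose κ' hκ' using hκn
    have h := Submodule.smul_mem _ ((-1 : ℚ) ^ (p + 1))
      (det_submatrix_mem_span (m := m) R ρ' κ' (fun b => hκ b _ (hκ' b)))
    convert! h using 1
    ext y
    have hneg : template ρ κ C y = -(y.submatrix ρ' κ') := by
      ext a b
      simp [template, hρ', hκ']
    rw [hneg, Matrix.det_neg, Pi.smul_apply, Rat.smul_def]
    simp

/-- A rational combination of `1` and the minors that vanishes at a point where these numbers are
independent vanishes identically. -/
theorem eq_zero_of_mem_span_minorFun {m n : ℕ} {R : Finset (Fin n)}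
    {x : Matrix (Fin m) (Fin n) ℝ} (hx : MinorsIndependent x R)
    {f : Matrix (Fin m) (Fin n) ℝ → ℝ} (hf : f ∈ Submodule.span ℚ (Set.range (minorFun m R)))
    (h0 : f x = 0) : f = 0 := by
  obtain ⟨c, rfl⟩ := Finsupp.mem_span_range_iff_exists_finsupp.1 hf
  have hc : c = 0 := by
    refine (linearIndependent_iff.1 hx) c ?_
    rw [Finsupp.linearCombination_apply, ← h0]
    simp only [Finsupp.sum, Finset.sum_apply, Pi.smul_apply]
    rfl
  simp [hc]

/-! ### Determinants of integer columns completed by unit vectors -/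

/-- The matrix with the integer vectors `Z j` as columns. -/
def intCols {ι : Type*} {k : ℕ} (Z : Fin k → ι → ℤ) : Matrix ι (Fin k) ℝ :=
  Matrix.of fun i j => (Z j i : ℝ)

/-- The matrix with the standard basis vectors `e_{c s}` as columns. -/
def unitCols {ι : Type*} [DecidableEq ι] {q : ℕ} (c : Fin q → ι) : Matrix ι (Fin q) ℝ :=
  Matrix.of fun i s => if i = c s then 1 else 0

/-- The determinant of a matrix whose columns are indexed through `e`. -/
noncomputable def colDet {ι κ : Type*} [Fintype ι] [DecidableEq ι] (e : ι ≃ κ)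
    (M : Matrix ι κ ℝ) : ℝ :=
  (M.submatrix id e).det

theorem colDet_mul_left {ι κ : Type*} [Fintype ι] [DecidableEq ι] (e : ι ≃ κ)
    (A : Matrix ι ι ℝ) (M : Matrix ι κ ℝ) : colDet e (A * M) = A.det * colDet e M := by
  rw [colDet, colDet, ← Matrix.det_mul]
  rfl

theorem colDet_mul_right {ι κ : Type*} [Fintype ι] [DecidableEq ι] [Fintype κ] [DecidableEq κ]
    (e : ι ≃ κ) (M : Matrix ι κ ℝ) (B : Matrix κ κ ℝ) :
    colDet e (M * B) = colDet e M * B.det := by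
  rw [colDet, colDet, ← Matrix.det_submatrix_equiv_self e B, ← Matrix.det_mul,
    Matrix.submatrix_mul_equiv]

theorem colDet_fromCols_mul {ι κ₁ κ₂ : Type*} [Fintype ι] [DecidableEq ι] [Fintype κ₁]
    [DecidableEq κ₁] [Fintype κ₂] [DecidableEq κ₂] (e : ι ≃ κ₁ ⊕ κ₂) (Z : Matrix ι κ₁ ℝ)
    (E : Matrix ι κ₂ ℝ) (Q : Matrix κ₁ κ₁ ℝ) (D : Matrix κ₂ κ₂ ℝ) :
    colDet e (Matrix.fromCols (Z * Q) (E * D)) =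
      colDet e (Matrix.fromCols Z E) * (Q.det * D.det) := by
  have h := Matrix.fromCols_mul_fromBlocks Z E Q 0 0 D
  rw [Matrix.mul_zero, Matrix.mul_zero, add_zero, zero_add] at h
  rw [← h, colDet_mul_right, Matrix.det_fromBlocks_zero₁₂]

theorem abs_colDet_le {ι κ : Type*} [Fintype ι] [DecidableEq ι] [Fintype κ] (e : ι ≃ κ)
    (M : Matrix ι κ ℝ) (r : κ → ℝ) (h : ∀ i j, |M i j| ≤ r j) :
    |colDet e M| ≤ (Fintype.card ι).factorial * ∏ j, r j := by
  rw [colDet, Matrix.det_apply']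
  refine (Finset.abs_sum_le_sum_abs _ _).trans ?_
  rw [← Fintype.card_perm, ← nsmul_eq_mul]
  refine Finset.sum_le_card_nsmul _ _ _ fun σ _ => ?_
  rw [abs_mul, abs_unit_intCast, one_mul, Finset.abs_prod, ← Equiv.prod_comp e]
  exact Finset.prod_le_prod (fun _ _ => abs_nonneg _) fun i _ => h _ _

theorem colDet_ne_zero_of_span_eq_top {ι κ : Type*} [Fintype ι] [DecidableEq ι] (e : ι ≃ κ)
    (M : Matrix ι κ ℝ) (h : Submodule.span ℝ (Set.range M.col) = ⊤) : colDet e M ≠ 0 := by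
  have hli : LinearIndependent ℝ (M.submatrix id e).col := by
    refine linearIndependent_of_top_le_span_of_card_eq_finrank ?_ (by simp)
    rw [← h]
    refine Submodule.span_mono ?_
    rintro _ ⟨j, rfl⟩
    exact ⟨e.symm j, by ext i; simp⟩
  rw [Matrix.linearIndependent_cols_iff_isUnit, Matrix.isUnit_iff_isUnit_det] at hli
  exact hli.ne_zero

/-- A linearly independent family is completed by standard basis vectors. -/
theorem exists_colDet_unitCols_ne_zero {ι : Type*} [Fintype ι] [DecidableEq ι] {k q : ℕ}
    (e : ι ≃ Fin k ⊕ Fin q) (Z : Fin k → ι → ℤ)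
    (hZ : LinearIndependent ℝ fun i => intVec (Z i)) :
    ∃ c : Fin q → ι, Function.Injective c ∧
      colDet e (Matrix.fromCols (intCols Z) (unitCols c)) ≠ 0 := by
  have hcard : Fintype.card ι = k + q := by simpa using Fintype.card_congr e
  have key : ∀ p ≤ q, ∃ c : Fin p → ι,
      k + p ≤ finrank ℝ (Submodule.span ℝ
        (Set.range (fun i => intVec (Z i)) ∪ Set.range fun s => intVec (Pi.single (c s) 1))) := by
    intro p
    induction p with
    | zero =>
      intro _
      refine ⟨Fin.elim0, ?_⟩
      have := finrank_span_eq_card hZ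
      rw [Set.range_eq_empty (fun s : Fin 0 => _), Set.union_empty, this]
      simp
    | succ p ih =>
      intro hp
      obtain ⟨c, hc⟩ := ih (by omega)
      set W := Submodule.span ℝ
        (Set.range (fun i => intVec (Z i)) ∪ Set.range fun s => intVec (Pi.single (c s) 1))
      -- W is spanned by fewer than d vectors, so it is never everything; a lower bound on the rank
      -- spares that argument.
      by_cases hW : W = ⊤
      · have : Nonempty ι := Fintype.card_pos_iff.1 (by omega)
        refine ⟨Fin.snoc c (Classical.arbitrary ι), ?_⟩
        have hle : W ≤ Submodule.span ℝ (Set.range (fun i => intVec (Z i)) ∪ Set.range fun s =>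
            intVec (Pi.single ((Fin.snoc c (Classical.arbitrary ι) : Fin (p + 1) → ι) s) 1)) := by
          refine Submodule.span_mono (Set.union_subset_union_right _ ?_)
          rintro _ ⟨s, rfl⟩
          exact ⟨s.castSucc, by simp⟩
        rw [hW, top_le_iff] at hle
        rw [hle, finrank_top, Module.finrank_pi]
        omega
      · have : ∃ i : ι, intVec (Pi.single i 1) ∉ W := by
          by_contra! hcon
          apply hW
          rw [eq_top_iff, ← (Pi.basisFun ℝ ι).span_eq, Submodule.span_le]
          rintro _ ⟨i, rfl⟩
          convert! hcon i using 1
          ext j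
          simp [intVec, Pi.single_apply]
        obtain ⟨i, hi⟩ := this
        refine ⟨Fin.snoc c i, ?_⟩
        have hlt : W < Submodule.span ℝ (Set.range (fun i => intVec (Z i)) ∪ Set.range fun s =>
            intVec (Pi.single ((Fin.snoc c i : Fin (p + 1) → ι) s) 1)) := by
          refine lt_of_le_of_ne ?_ fun heq => hi ?_
          · refine Submodule.span_mono (Set.union_subset_union_right _ ?_)
            rintro _ ⟨s, rfl⟩
            exact ⟨s.castSucc, by simp⟩
          · rw [heq]
            exact Submodule.subset_span (Or.inr ⟨Fin.last p, by simp⟩)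
        have := Submodule.finrank_lt_finrank_of_lt hlt
        omega
  obtain ⟨c, hc⟩ := key q le_rfl
  have hne : colDet e (Matrix.fromCols (intCols Z) (unitCols c)) ≠ 0 := by
    refine colDet_ne_zero_of_span_eq_top _ _ ?_
    refine Submodule.eq_top_of_finrank_eq (le_antisymm (Submodule.finrank_le _) ?_)
    rw [Module.finrank_pi, hcard]
    refine hc.trans (Submodule.finrank_mono (Submodule.span_mono ?_))
    rintro _ (⟨i, rfl⟩ | ⟨s, rfl⟩)
    · exact ⟨Sum.inl i, by ext a; simp [intCols, intVec]⟩
    · exact ⟨Sum.inr s, by ext a; simp [unitCols, intVec, Pi.single_apply]⟩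
  refine ⟨c, fun s s' hss => ?_, hne⟩
  by_contra hcon
  refine hne (Matrix.det_zero_of_column_eq (i := e.symm (Sum.inr s)) (j := e.symm (Sum.inr s'))
    (by simpa using hcon) fun a => ?_)
  simp [unitCols, hss]

theorem exists_int_colDet {ι : Type*} [Fintype ι] [DecidableEq ι] {k q : ℕ}
    (e : ι ≃ Fin k ⊕ Fin q) (Z : Fin k → ι → ℤ) (c : Fin q → ι) :
    ∃ N : ℤ, colDet e (Matrix.fromCols (intCols Z) (unitCols c)) = N := by
  refine ⟨(Matrix.of fun i j : ι =>
    Sum.elim (fun s => Z s i) (fun s => if i = c s then (1 : ℤ) else 0) (e j)).det, ?_⟩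
  rw [colDet, Int.cast_det]
  congr 1
  ext i j
  rcases h : e j with s | s <;> simp [h, intCols, unitCols]

theorem uMat_mul_neg {m n : ℕ} (x : Matrix (Fin m) (Fin n) ℝ) : uMat x * uMat (-x) = 1 := by
  simp [uMat, Matrix.fromBlocks_multiply]

theorem mul_unitCols_apply {ι : Type*} [Fintype ι] [DecidableEq ι] {q : ℕ} (A : Matrix ι ι ℝ)
    (c : Fin q → ι) (i : ι) (s : Fin q) : (A * unitCols c) i s = A i (c s) := by
  simp [Matrix.mul_apply, unitCols]

/-- The matrix a_t u(x) has determinant 1 and maps u(-x) e_c to a multiple of e_c by the exponential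
of its exponent. -/
theorem colDet_flowMat {m n : ℕ} {ω : Space m n} (hω : IsWeightVector ω)
    (x : Matrix (Fin m) (Fin n) ℝ) (t : ℝ) {k q : ℕ} (e : Fin m ⊕ Fin n ≃ Fin k ⊕ Fin q)
    (Z : Matrix (Fin m ⊕ Fin n) (Fin k) ℝ) (c : Fin q → Fin m ⊕ Fin n) :
    colDet e (Matrix.fromCols (flowMat ω x t * Z) (unitCols c)) =
      colDet e (Matrix.fromCols Z (uMat (-x) * unitCols c)) *
        Real.exp ((∑ s, -flowExp ω (c s)) * t) := by
  set D : Matrix (Fin q) (Fin q) ℝ := Matrix.diagonal fun s => Real.exp (-flowExp ω (c s) * t)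
  have hunit : flowMat ω x t * (uMat (-x) * unitCols c * D) = unitCols c := by
    rw [flowMat, Matrix.mul_assoc, Matrix.mul_assoc (uMat (-x)), ← Matrix.mul_assoc (uMat x),
      uMat_mul_neg, Matrix.one_mul, flow_eq]
    ext i s
    rw [Matrix.diagonal_mul, Matrix.mul_diagonal]
    simp only [unitCols, Matrix.of_apply]
    split_ifs with h
    · rw [h, one_mul, ← Real.exp_add]
      simp
    · simp
  have hmat := Matrix.mul_fromCols (flowMat ω x t) Z (uMat (-x) * unitCols c * D)
  have hD := colDet_fromCols_mul e Z (uMat (-x) * unitCols c) 1 D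
  rw [Matrix.mul_one, Matrix.det_one, one_mul, Matrix.det_diagonal, ← Real.exp_sum,
    ← Finset.sum_mul] at hD
  rw [hunit] at hmat
  rw [← hmat, colDet_mul_left, det_flowMat hω, one_mul, hD]

theorem eq_zero_of_mul_exp_le {D C η T : ℝ} (hη : 0 < η)
    (h : ∀ t, T ≤ t → |D| * Real.exp (η * t) ≤ C) : D = 0 := by
  by_contra hD
  have hD' : 0 < |D| := abs_pos.2 hD
  have htend : Filter.Tendsto (fun t => |D| * Real.exp (η * t)) Filter.atTop Filter.atTop :=
    (Real.tendsto_exp_atTop.comp (Filter.tendsto_id.const_mul_atTop hη)).const_mul_atTop hD'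
  obtain ⟨t, ht1, ht2⟩ := ((htend.eventually_gt_atTop C).and (Filter.eventually_ge_atTop T)).exists
  exact absurd (h t ht2) (not_le.2 ht1)

/-- If `L^ω(Λ_x, ·)` is not connected at `k`, then some rational `k`-dimensional subspace meets
`u(-x) ⟨e_c⟩` nontrivially for every choice of coordinates `c` of negative total exponent. -/
theorem exists_colDet_eq_zero_of_not_connectedAt {m n : ℕ} {ω : Space m n}
    (hω : IsWeightVector ω) (x : Matrix (Fin m) (Fin n) ℝ) {k q : ℕ} (hkq : k + q = m + n)
    (hq : 1 ≤ q) (e : Fin m ⊕ Fin n ≃ Fin k ⊕ Fin q) (h : ¬ ConnectedAt ω (latticeOf x) k) :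
    ∃ Z : Fin k → Fin m ⊕ Fin n → ℤ, LinearIndependent ℝ (fun i => intVec (Z i)) ∧
      ∀ c : Fin q → Fin m ⊕ Fin n, ∑ s, flowExp ω (c s) < 0 →
        colDet e (Matrix.fromCols (intCols Z) (uMat (-x) * unitCols c)) = 0 := by
  obtain ⟨T, V, hVk, hV⟩ := exists_shortSpan_eq_of_not_connectedAt hω x (by omega) h
  have hdet : ∀ t, |(flowMat ω x t).det| = 1 := fun t => by rw [det_flowMat hω]; simp
  have hkd : k ≤ m + n := by omega
  set C : ℝ := max 1 (((m + n : ℕ) : ℝ) ^ (m + n))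
  have hred : ∀ t, T ≤ t → ∃ Y : Fin k → Fin m ⊕ Fin n → ℤ,
      LinearIndependent ℝ (fun i => intVec (Y i)) ∧ (∀ i, intVec (Y i) ∈ V) ∧
      ∏ i, ‖(flowMat ω x t).mulVec (intVec (Y i))‖ ≤ C := by
    intro t ht
    obtain ⟨y, hy⟩ := exists_isReduced (flowMat ω x t)
      (by rw [det_flowMat hω]; exact isUnit_one) (m + n) (by simp)
    obtain ⟨r, hr⟩ := hV t ht
    refine ⟨fun i => y (Fin.castLE hkd i),
      hy.linearIndependent.comp _ (Fin.castLE_injective hkd), fun i => ?_,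
      hy.prod_norm_castLE_le (hdet t) (by simp) hkd⟩
    rw [← hr]
    exact hy.mem_shortSpan r _ (by rw [hr, hVk]; simp)
  obtain ⟨Z, hZ, hZV, -⟩ := hred T le_rfl
  have hspan : Submodule.span ℝ (Set.range fun i => intVec (Z i)) = V := by
    refine Submodule.eq_of_le_of_finrank_eq (Submodule.span_le.2 ?_) ?_
    · rintro _ ⟨i, rfl⟩
      exact hZV i
    · rw [finrank_span_eq_card hZ, hVk, Fintype.card_fin]
  obtain ⟨c₀, -, hc₀⟩ := exists_colDet_unitCols_ne_zero e Z hZ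
  set δ := colDet e (Matrix.fromCols (intCols Z) (unitCols c₀))
  refine ⟨Z, hZ, fun c hc => ?_⟩
  refine eq_zero_of_mul_exp_le (η := ∑ s, -flowExp ω (c s)) (T := T)
    (C := |δ| * ((m + n).factorial * C)) (by simpa using hc) fun t ht => ?_
  obtain ⟨Y, hY, hYV, hYC⟩ := hred t ht
  have hcoef : ∀ j, ∃ a : Fin k → ℝ, ∑ i, a i • intVec (Z i) = intVec (Y j) := fun j => by
    rw [← Submodule.mem_span_range_iff_exists_fun, hspan]
    exact hYV j
  choose a ha using hcoef
  set Q : Matrix (Fin k) (Fin k) ℝ := Matrix.of fun i j => a j i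
  have hYZ : intCols Y = intCols Z * Q := by
    ext i j
    have := congrFun (ha j) i
    simp only [Finset.sum_apply, Pi.smul_apply, smul_eq_mul] at this
    simp only [Matrix.mul_apply, Q, Matrix.of_apply]
    refine this.symm.trans (Finset.sum_congr rfl fun l _ => mul_comm _ _)
  have hcolQ : ∀ (A : Matrix (Fin m ⊕ Fin n) (Fin m ⊕ Fin n) ℝ) (c : Fin q → Fin m ⊕ Fin n),
      colDet e (Matrix.fromCols (A * intCols Y) (unitCols c)) =
        colDet e (Matrix.fromCols (A * intCols Z) (unitCols c)) * Q.det := by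
    intro A c
    have hD := colDet_fromCols_mul e (A * intCols Z) (unitCols c) Q 1
    rwa [Matrix.mul_one, Matrix.det_one, mul_one, Matrix.mul_assoc, ← hYZ] at hD
  have hQ0 : Q.det ≠ 0 := by
    obtain ⟨c₁, -, hc₁⟩ := exists_colDet_unitCols_ne_zero e Y hY
    intro h0
    have := hcolQ 1 c₁
    rw [h0, mul_zero, Matrix.one_mul] at this
    exact hc₁ this
  -- By the change of basis Y = Z Q, δ det Q is the determinant of the integer matrix (Y | e_{c₀}).
  -- It is a nonzero integer, which bounds det Q below uniformly in t.
  have hQ : 1 ≤ |δ| * |Q.det| := by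
    obtain ⟨N, hN⟩ := exists_int_colDet e Y c₀
    have h1 := hcolQ 1 c₀
    rw [Matrix.one_mul, Matrix.one_mul, hN] at h1
    rw [← abs_mul, ← h1, ← Int.cast_abs]
    have hN0 : N ≠ 0 := by
      rintro rfl
      rw [Int.cast_zero] at h1
      exact mul_ne_zero hc₀ hQ0 h1.symm
    exact_mod_cast Int.one_le_abs hN0
  have hbound : |colDet e (Matrix.fromCols (flowMat ω x t * intCols Y) (unitCols c))| ≤
      (m + n).factorial * C := by
    refine (abs_colDet_le e _ (Sum.elim
      (fun i => ‖(flowMat ω x t).mulVec (intVec (Y i))‖) fun _ => 1) ?_).trans ?_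
    · rintro i (j | s)
      · exact norm_le_pi_norm ((flowMat ω x t).mulVec (intVec (Y j))) i
      · simp only [Matrix.fromCols_apply_inr, unitCols, Matrix.of_apply, Sum.elim_inr]
        split_ifs <;> simp
    · rw [Fintype.prod_sum_type]
      simp only [Sum.elim_inl, Sum.elim_inr, Finset.prod_const_one, mul_one, Fintype.card_sum,
        Fintype.card_fin]
      gcongr
  have hexp := colDet_flowMat hω x t e (intCols Z) c
  rw [hcolQ, abs_mul] at hbound
  rw [← abs_of_pos (Real.exp_pos ((∑ s, -flowExp ω (c s)) * t)), ← abs_mul, ← hexp]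
  calc _ ≤ |colDet e (Matrix.fromCols (flowMat ω x t * intCols Z) (unitCols c))| *
        (|δ| * |Q.det|) := le_mul_of_one_le_right (abs_nonneg _) hQ
    _ = |δ| * (|colDet e (Matrix.fromCols (flowMat ω x t * intCols Z) (unitCols c))| *
        |Q.det|) := by ring
    _ ≤ _ := by gcongr

/-- Nonconstant entries occur only in left rows and in columns u(-y) e_j with j a right coordinate,
where they are entries of -y. -/
theorem colDet_mem_span_minorFun {m n k q : ℕ} (e : Fin m ⊕ Fin n ≃ Fin k ⊕ Fin q)
    (Z : Fin k → Fin m ⊕ Fin n → ℤ) (c : Fin q → Fin m ⊕ Fin n) (R : Finset (Fin n))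
    (hR : ∀ s j, c s = Sum.inr j → j ∈ R) :
    (fun y : Matrix (Fin m) (Fin n) ℝ =>
        colDet e (Matrix.fromCols (intCols Z) (uMat (-y) * unitCols c))) ∈
      Submodule.span ℚ (Set.range (minorFun m R)) := by
  let f : Fin (m + n) ≃ Fin m ⊕ Fin n := finSumFinEquiv.symm
  let κ' : Fin k ⊕ Fin q → Option (Fin n) := Sum.elim (fun _ => none) fun s => (c s).getRight?
  let C' : Fin m ⊕ Fin n → Fin k ⊕ Fin q → ℚ := fun i =>
    Sum.elim (fun s => (Z s i : ℚ)) fun s => if i = c s then 1 else 0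
  have := template_det_mem_span (m := m) R (fun a => (f a).getLeft?) (fun b => κ' (e (f b)))
    (by
      intro b j hj
      rcases h : e (f b) with s | s
      · simp [κ', h] at hj
      · refine hR s j ?_
        simpa [κ', h] using hj)
    (Matrix.of fun a b => C' (f a) (e (f b)))
  convert! this using 1
  ext y
  rw [colDet, ← Matrix.det_submatrix_equiv_self f]
  congr 1
  ext a b
  simp only [Matrix.submatrix_apply, template, Matrix.of_apply, id]
  rcases h : e (f b) with s | s
  · rcases f a with i | i <;> simp [κ', C', intCols]
  · rw [Matrix.fromCols_apply_inr, mul_unitCols_apply]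
    rcases f a with i | i <;> rcases h' : c s with j | j <;>
      simp [κ', C', h', uMat, Matrix.one_apply, apply_ite (Rat.cast : ℚ → ℝ)]

/-! ### Moving coordinates from left to right -/

/-- Replacing some left coordinates by right ones cannot destroy transversality for all `y`. -/
theorem exists_colDet_uMat_ne_zero {m n k q : ℕ} (e : Fin m ⊕ Fin n ≃ Fin k ⊕ Fin q)
    (Z : Matrix (Fin m ⊕ Fin n) (Fin k) ℝ) (c c' : Fin q → Fin m ⊕ Fin n)
    (hc : Function.Injective c)
    (hcc : ∀ s, c s = c' s ∨ ∃ i j, c' s = Sum.inl i ∧ c s = Sum.inr j)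
    (h : colDet e (Matrix.fromCols Z (unitCols c')) ≠ 0) :
    ∃ y : Matrix (Fin m) (Fin n) ℝ, colDet e (Matrix.fromCols Z (uMat y * unitCols c)) ≠ 0 := by
  by_contra! hzero
  -- The columns are e_{c'} + ε e_c where c and c' differ. For ε ≠ 0 they are rescaled columns of
  -- u(y) e_c with entries ε⁻¹ in y; at ε = 0 they are e_{c'}. Vanishing for all ε ≠ 0 passes to ε =
  -- 0 by continuity.
  let F : ℝ → Matrix (Fin m ⊕ Fin n) (Fin q) ℝ := fun ε => Matrix.of fun a s =>
    (if a = c' s then 1 else 0) + if c s = c' s then 0 else if a = c s then ε else 0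
  have hcont : Continuous fun ε => colDet e (Matrix.fromCols Z (F ε)) := by
    refine Continuous.matrix_det (continuous_matrix fun a b => ?_)
    simp only [Matrix.submatrix_apply, id]
    rcases e b with s | s
    · exact continuous_const
    · simp only [Matrix.fromCols_apply_inr, F, Matrix.of_apply]
      split_ifs <;> fun_prop
  have hF0 : F 0 = unitCols c' := by
    ext a s
    simp [F, unitCols]
  have hne : ∀ ε ∈ ({0} : Set ℝ)ᶜ, colDet e (Matrix.fromCols Z (F ε)) = 0 := by
    intro ε hε
    have hε0 : ε ≠ 0 := hε
    let y : Matrix (Fin m) (Fin n) ℝ := Matrix.of fun i j =>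
      if ∃ s, c' s = Sum.inl i ∧ c s = Sum.inr j then ε⁻¹ else 0
    let D : Matrix (Fin q) (Fin q) ℝ := Matrix.diagonal fun s => if c s = c' s then 1 else ε
    have hmat : F ε = uMat y * unitCols c * D := by
      ext a s
      rw [Matrix.mul_diagonal, mul_unitCols_apply]
      have hy : ∀ i j, c s = Sum.inr j → y i j = if c' s = Sum.inl i then ε⁻¹ else 0 := by
        intro i j hj
        simp only [y, Matrix.of_apply]
        refine if_congr ⟨?_, fun h => ⟨s, h, hj⟩⟩ rfl rfl
        -- Injectivity of c: each column of y is used by a single s.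
        rintro ⟨s', h1, h2⟩
        rwa [hc (h2.trans hj.symm)] at h1
      rcases hcc s with hs | ⟨i, j, hi, hj⟩
      · simp only [F, Matrix.of_apply, hs, if_true, add_zero, mul_one]
        rcases h' : c' s with i | j
        · rcases a with a | a <;> simp [uMat, Matrix.one_apply]
        · rcases a with a | a
          · simp [uMat, hy a j (hs.trans h'), h']
          · simp [uMat, Matrix.one_apply]
      · simp only [F, Matrix.of_apply, hi, hj]
        rcases a with a | a
        · simp [uMat, hy a j hj, hi, eq_comm, hε0]
        · simp [uMat, Matrix.one_apply]
    have hD := colDet_fromCols_mul e Z (uMat y * unitCols c) 1 D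
    rwa [Matrix.mul_one, hzero, zero_mul, ← hmat] at hD
  have hall := hcont.ext_on (dense_compl_singleton (0 : ℝ)) (continuous_const (y := (0 : ℝ))) hne
  have := congrFun hall 0
  rw [hF0] at this
  exact h this

/-- Change a set of `q` coordinates by moving some of the left ones into a set `T`. -/
theorem exists_injective_move {m n q : ℕ} (c' : Fin q → Fin m ⊕ Fin n)
    (hc' : Function.Injective c') (S : Finset (Fin q)) (hS : ∀ s, s ∉ S → (c' s).isLeft)
    (T : Finset (Fin m ⊕ Fin n)) (hST : S.image c' ⊆ T) (hT : ∀ a ∈ T, a.isLeft → a ∈ S.image c')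
    (hTq : T.card = q) :
    ∃ c : Fin q → Fin m ⊕ Fin n, Function.Injective c ∧
      (∀ s, c s = c' s ∨ ∃ i j, c' s = Sum.inl i ∧ c s = Sum.inr j) ∧ ∀ a, a ∈ T ↔ ∃ s, c s = a := by
  obtain ⟨g, hg⟩ := Finset.exists_equiv_extend_of_card_eq (by simp [hTq]) hST hc'.injOn
  refine ⟨fun s => g s, fun s s' h => g.injective (Subtype.ext h), fun s => ?_, fun a => ?_⟩
  · by_cases hs : s ∈ S
    · exact Or.inl (hg s hs)
    · right
      obtain ⟨i, hi⟩ := Sum.isLeft_iff.1 (hS s hs)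
      rcases h : (g s : Fin m ⊕ Fin n) with i' | j
      · exfalso
        have := hT (g s) (g s).2 (by rw [h]; rfl)
        obtain ⟨s', hs', heq⟩ := Finset.mem_image.1 this
        rw [← hg s' hs'] at heq
        rw [← g.injective (Subtype.ext heq)] at hs
        exact hs hs'
      · exact ⟨i, j, hi, h⟩
  · constructor
    · intro ha
      exact ⟨g.symm ⟨a, ha⟩, by simp⟩
    · rintro ⟨s, rfl⟩
      exact (g s).2

theorem exists_injective_right {m n q : ℕ} (c' : Fin q → Fin m ⊕ Fin n)
    (hc' : Function.Injective c') (hq : q ≤ n) :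
    ∃ c : Fin q → Fin m ⊕ Fin n, Function.Injective c ∧
      (∀ s, c s = c' s ∨ ∃ i j, c' s = Sum.inl i ∧ c s = Sum.inr j) ∧
      ∀ s, ∃ j, c s = Sum.inr j := by
  set rights : Finset (Fin m ⊕ Fin n) := Finset.univ.filter fun a => a.isRight
  have hrights : rights.card = n := by
    have : rights = Finset.univ.map Function.Embedding.inr := by
      ext a; cases a <;> simp [rights]
    rw [this]; simp
  set S := Finset.univ.filter fun s => (c' s).isRight
  obtain ⟨T, hST, hTr, hTq⟩ := Finset.exists_subsuperset_card_eq (s := S.image c') (t := rights)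
    (n := q) (by
      intro a ha
      obtain ⟨s, hs, rfl⟩ := Finset.mem_image.1 ha
      simpa [S, rights] using hs)
    (Finset.card_image_le.trans (by simpa using Finset.card_le_univ S)) (by rw [hrights]; exact hq)
  have hright : ∀ a ∈ T, a.isRight := fun a ha => by simpa [rights] using hTr ha
  obtain ⟨c, h1, h2, h3⟩ := exists_injective_move c' hc' S (by simp [S]) T hST
    (fun a ha hl => by have := hright a ha; cases a <;> simp_all) hTq
  exact ⟨c, h1, h2, fun s => Sum.isRight_iff.1 (hright _ ((h3 _).2 ⟨s, rfl⟩))⟩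

theorem exists_injective_contains_right {m n q : ℕ} (c' : Fin q → Fin m ⊕ Fin n)
    (hc' : Function.Injective c') (hq : n ≤ q) :
    ∃ c : Fin q → Fin m ⊕ Fin n, Function.Injective c ∧
      (∀ s, c s = c' s ∨ ∃ i j, c' s = Sum.inl i ∧ c s = Sum.inr j) ∧
      ∀ j, ∃ s, c s = Sum.inr j := by
  set rights : Finset (Fin m ⊕ Fin n) := Finset.univ.filter fun a => a.isRight
  have hrights : rights.card = n := by
    have : rights = Finset.univ.map Function.Embedding.inr := by
      ext a; cases a <;> simp [rights]
    rw [this]; simp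
  set S₀ := Finset.univ.filter fun s => (c' s).isRight
  have hS₀ : S₀.card ≤ n := by
    rw [← hrights, ← Finset.card_image_of_injective S₀ hc']
    refine Finset.card_le_card fun a ha => ?_
    obtain ⟨s, hs, rfl⟩ := Finset.mem_image.1 ha
    simpa [S₀, rights] using hs
  -- Exactly q - n left coordinates stay in place, which leaves room for all n right ones.
  obtain ⟨S₁, hS₁, hS₁q⟩ := Finset.exists_subset_card_eq (s := S₀ᶜ) (n := q - n) (by
    rw [Finset.card_compl, Fintype.card_fin]; omega)
  have hS₁left : ∀ s ∈ S₁, (c' s).isLeft := fun s hs => by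
    have := hS₁ hs
    simpa [S₀] using this
  obtain ⟨c, h1, h2, h3⟩ := exists_injective_move c' hc' (S₀ ∪ S₁)
    (fun s hs => by simp [S₀] at hs; exact hs.1)
    (rights ∪ S₁.image c')
    (by
      rw [Finset.image_union]
      refine Finset.union_subset_union_left fun a ha => ?_
      obtain ⟨s, hs, rfl⟩ := Finset.mem_image.1 ha
      simpa [S₀, rights] using hs)
    (fun a ha hl => by
      rcases Finset.mem_union.1 ha with h | h
      · simp only [rights, Finset.mem_filter] at h
        cases a <;> simp_all
      · rw [Finset.image_union]
        exact Finset.mem_union_right _ h)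
    (by
      rw [Finset.card_union_of_disjoint, hrights, Finset.card_image_of_injective _ hc', hS₁q]
      · omega
      · rw [Finset.disjoint_left]
        intro a ha ha'
        obtain ⟨s, hs, rfl⟩ := Finset.mem_image.1 ha'
        have := hS₁left s hs
        simp only [rights, Finset.mem_filter] at ha
        cases h : c' s <;> simp_all)
  exact ⟨c, h1, h2, fun j => (h3 _).1 (Finset.mem_union_left _ (by simp [rights]))⟩

/-! ### The criterion and the two ranges of k -/

/-- The criterion behind both parts: connectedness at `k` follows once every set `c'` of
`d - k` coordinates can be moved to one of negative total exponent whose right coordinates span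
columns with independent minors. -/
theorem connectedAt_of_forall_exists {m n : ℕ} {ω : Space m n} (hω : IsWeightVector ω)
    (x : Matrix (Fin m) (Fin n) ℝ) {k q : ℕ} (hkq : k + q = m + n) (hq : 1 ≤ q)
    (h : ∀ c' : Fin q → Fin m ⊕ Fin n, Function.Injective c' →
      ∃ c : Fin q → Fin m ⊕ Fin n, Function.Injective c ∧
        (∀ s, c s = c' s ∨ ∃ i j, c' s = Sum.inl i ∧ c s = Sum.inr j) ∧
        ∑ s, flowExp ω (c s) < 0 ∧
        ∃ R : Finset (Fin n), MinorsIndependent x R ∧ ∀ s j, c s = Sum.inr j → j ∈ R) :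
    ConnectedAt ω (latticeOf x) k := by
  by_contra hcon
  let e : Fin m ⊕ Fin n ≃ Fin k ⊕ Fin q := Fintype.equivOfCardEq (by simp [hkq])
  obtain ⟨Z, hZ, hZc⟩ := exists_colDet_eq_zero_of_not_connectedAt hω x hkq hq e hcon
  obtain ⟨c', hc', hne⟩ := exists_colDet_unitCols_ne_zero e Z hZ
  obtain ⟨c, hc, hcc, hneg, R, hR, hcR⟩ := h c' hc'
  obtain ⟨y, hy⟩ := exists_colDet_uMat_ne_zero e (intCols Z) c c' hc hcc hne
  have hzero := eq_zero_of_mem_span_minorFun hR (colDet_mem_span_minorFun e Z c R hcR) (hZc c hneg)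
  have := congrFun hzero (-y)
  simp only [neg_neg] at this
  exact hy this

end ParamGeom

theorem mainTheorem6 (m n : ℕ) (hm : 1 ≤ m) (hn : 1 ≤ n)
    (ω : ParamGeom.Space m n) (hω : ParamGeom.IsWeightVector ω)
    (x : Matrix (Fin m) (Fin n) ℝ) :
    (∀ k : ℕ, m ≤ k → k ≤ m + n - 1 →
      (∀ R : Finset (Fin n), R.card = m + n - k → ParamGeom.MinorsIndependent x R) →
      ParamGeom.ConnectedAt ω (ParamGeom.latticeOf x) k) ∧
    (∀ k : ℕ, 1 ≤ k → k ≤ m →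
      ParamGeom.MinorsIndependent x (Finset.univ : Finset (Fin n)) →
      ParamGeom.ConnectedAt ω (ParamGeom.latticeOf x) k) := by
  constructor
  · intro k hmk hk hR
    have hq : 1 ≤ m + n - k := by omega
    refine ParamGeom.connectedAt_of_forall_exists hω x (q := m + n - k) (by omega) hq
      fun c' hc' => ?_
    obtain ⟨c, hc, hcc, hright⟩ := ParamGeom.exists_injective_right c' hc' (by omega)
    choose j hj using hright
    refine ⟨c, hc, hcc, ?_, Finset.univ.image j, hR _ ?_, fun s i hi => ?_⟩
    · have : Nonempty (Fin (m + n - k)) := ⟨⟨0, hq⟩⟩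
      refine Finset.sum_neg (fun s _ => ?_) Finset.univ_nonempty
      simpa [hj, ParamGeom.flowExp] using hω.pos (Sum.inr (j s))
    · rw [Finset.card_image_of_injective, Finset.card_univ, Fintype.card_fin]
      intro s s' h
      exact hc (by rw [hj, hj, h])
    · rw [hj] at hi
      exact Finset.mem_image.2 ⟨s, Finset.mem_univ s, Sum.inr_injective hi⟩
  · intro k hk1 hkm hR
    refine ParamGeom.connectedAt_of_forall_exists hω x (q := m + n - k) (by omega) (by omega)
      fun c' hc' => ?_
    obtain ⟨c, hc, hcc, hright⟩ := ParamGeom.exists_injective_contains_right c' hc' (by omega)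
    refine ⟨c, hc, hcc, ?_, Finset.univ, hR, fun _ _ _ => Finset.mem_univ _⟩
    have h1 : ∑ s, ParamGeom.flowExp ω (c s) =
        ∑ a ∈ Finset.univ.image c, ParamGeom.flowExp ω a :=
      (Finset.sum_image fun _ _ _ _ h => hc h).symm
    -- All exponents sum to 0, so it suffices that the omitted coordinates, all left and k in
    -- number, have positive total.
    have h2 := Finset.sum_add_sum_compl (Finset.univ.image c) (ParamGeom.flowExp ω)
    rw [hω.sum_flowExp] at h2
    have h3 : 0 < ∑ a ∈ (Finset.univ.image c)ᶜ, ParamGeom.flowExp ω a := by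
      refine Finset.sum_pos (fun a ha => ?_) ?_
      · rcases a with i | j
        · exact hω.pos _
        · obtain ⟨s, hs⟩ := hright j
          simp at ha
          exact absurd hs (ha s)
      · rw [← Finset.card_pos, Finset.card_compl, Finset.card_image_of_injective _ hc]
        simp
        omega
    linarith
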